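/- Let $\mathcal H$ be a complex Hilbert space and let $\mathcal T:\mathbb R\to B(\mathcal H)$ be a strongly continuous representation of the additive group $\mathbb R$ by isometries. For $f\in L^1(\mathbb R)$ and $y\in\mathcal H$ put $fy=\int_{\mathbb R} f(t)\,\mathcal T(-t)y\,dt$ and $\widehat f(\xi)=\int_{\mathbb R} f(t)e^{-it\xi}\,dt$. The Beurling spectrum $\Lambda(\mathcal H,\mathcal T)$ is the set of all $\xi\in\mathbb R$ such that $\widehat f(\xi)=0$ for every $f\in L^1(\mathbb R)$ with $fy=0$ for all $y\in\mathcal H$. Suppose that $\Lambda(\mathcal H,\mathcal T)\subseteq[-\gamma,\gamma]$ for some $\gamma>0$. Let $x\in\mathcal H$ and let $(\gamma_n)_{n\in\mathbb Z}$ be a sequence of real numbers such that $\{\mathcal T(\gamma_n)x\}_{n\in\mathbb Z}$ is a frame for $\mathcal H$ with bounds $B\ge A>0$, that is, $A\|y\|^2\le\sum_{n\in\mathbb Z}|\langle y,\mathcal T(\gamma_n)x\rangle|^2\le B\|y\|^2$ for all $y\in\mathcal H$. Let $(\widetilde\gamma_n)_{n\in\mathbb Z}$ be a sequence of real numbers and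 let $\delta\in\mathbb R$ be such that $$|\widetilde\gamma_n-\gamma_n|\le\delta\ \text{ for all } n\in\mathbb Z,\qquad \delta<\frac{\pi}{4\gamma}-\frac1\gamma\arcsin\left(\frac1{\sqrt2}\left(1-\sqrt{\frac AB}\right)\right)$$ (for instance $\delta=\sup_n|\widetilde\gamma_n-\gamma_n|$, if this supremum satisfies the second inequality). Then $\{\mathcal T(\widetilde\gamma_n)x\}_{n\in\mathbb Z}$ is also a frame for $\mathcal H$, with (positive) lower bound and upper bound $$A\left(1-\sqrt{\frac BA}\,(1-\cos\delta\gamma+\sin\delta\gamma)\right)^2\quad\text{and}\quad B\,(2-\cos\delta\gamma+\sin\delta\gamma)^2 .$$ If, in addition, $\{\mathcal T(\gamma_n)x\}_{n\in\mathbb Z}$ is a Riesz basis for $\mathcal H$, then so is $\{\mathcal T(\widetilde\gamma_n)x\}_{n\in\mathbb Z}$. Here a sequence $(\varphi_n)_{n\in\mathbb Z}$ is a Riesz basis for $\mathcal H$ if its linear span is dense in $\mathcal H$ and there are constants $B'\ge A'>0$ such that, for every $c\in\ell^2(\mathbb Z)$, the series $\sum_n c_n\varphi_n$ converges unconditionally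 and $A'\|c\|_2^2\le\|\sum_n c_n\varphi_n\|^2\le B'\|c\|_2^2$. -/

import Mathlib

open MeasureTheory

/-- `T : ℝ → B(X)` is a strongly continuous representation of the additive group `ℝ`
by linear isometries of the complex normed space `X`. -/
structure IsIsometricRep {X : Type*} [NormedAddCommGroup X] [NormedSpace ℂ X]
    (T : ℝ → X →L[ℂ] X) : Prop where
  map_zero : T 0 = ContinuousLinearMap.id ℂ X
  map_add : ∀ s t : ℝ, T (s + t) = (T s).comp (T t)
  norm_map : ∀ (t : ℝ) (x : X), ‖T t x‖ = ‖x‖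
  continuous_orbit : ∀ x : X, Continuous fun t : ℝ => T t x

/-- The action `f x = ∫ f(t) T(-t) x dt` of `L¹(ℝ)` on `X` associated with `T`. -/
noncomputable def moduleAction {X : Type*} [NormedAddCommGroup X] [NormedSpace ℂ X]
    (T : ℝ → X →L[ℂ] X) (f : ℝ → ℂ) (x : X) : X :=
  ∫ t : ℝ, f t • T (-t) x

/-- The Fourier transform `f̂(ξ) = ∫ f(t) exp(-itξ) dt`. -/
noncomputable def fourierL1 (f : ℝ → ℂ) (ξ : ℝ) : ℂ :=
  ∫ t : ℝ, f t * Complex.exp (-(Complex.I * t * ξ))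

/-- The Beurling spectrum `Λ(N, T)` of a subset `N` of `X`: all real `ξ` such that `f̂(ξ) = 0`
whenever `f ∈ L¹(ℝ)` annihilates every element of `N`. -/
def beurlingSpectrum {X : Type*} [NormedAddCommGroup X] [NormedSpace ℂ X]
    (T : ℝ → X →L[ℂ] X) (N : Set X) : Set ℝ :=
  {ξ : ℝ | ∀ f : ℝ → ℂ, Integrable f → (∀ x ∈ N, moduleAction T f x = 0) → fourierL1 f ξ = 0}

/-- The sequence `φ` is a frame for `H` with bounds `B ≥ A > 0`. -/
structure IsFrameWithBounds {H : Type*} [NormedAddCommGroup H] [InnerProductSpace ℂ H]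
    (φ : ℤ → H) (A B : ℝ) : Prop where
  lower_pos : 0 < A
  lower_le_upper : A ≤ B
  summable : ∀ y : H, Summable fun n : ℤ => ‖inner ℂ y (φ n)‖ ^ 2
  lower : ∀ y : H, A * ‖y‖ ^ 2 ≤ ∑' n : ℤ, ‖inner ℂ y (φ n)‖ ^ 2
  upper : ∀ y : H, ∑' n : ℤ, ‖inner ℂ y (φ n)‖ ^ 2 ≤ B * ‖y‖ ^ 2

/-- The sequence `φ` is a Riesz basis for `H` with bounds `B ≥ A > 0`: it is complete in `H`, and
`∑ cₙ φₙ` converges and satisfies the two-sided Riesz estimate for every `c ∈ ℓ²(ℤ)`. -/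
structure IsRieszBasisWithBounds {H : Type*} [NormedAddCommGroup H] [InnerProductSpace ℂ H]
    (φ : ℤ → H) (A B : ℝ) : Prop where
  lower_pos : 0 < A
  lower_le_upper : A ≤ B
  complete : (Submodule.span ℂ (Set.range φ)).topologicalClosure = ⊤
  summable : ∀ c : lp (fun _ : ℤ => ℂ) 2, Summable fun n : ℤ => c n • φ n
  lower : ∀ c : lp (fun _ : ℤ => ℂ) 2, A * ‖c‖ ^ 2 ≤ ‖∑' n : ℤ, c n • φ n‖ ^ 2
  upper : ∀ c : lp (fun _ : ℤ => ℂ) 2, ‖∑' n : ℤ, c n • φ n‖ ^ 2 ≤ B * ‖c‖ ^ 2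

/-- The sequence `φ` is a Riesz basis for `H` (with some bounds). -/
def IsRieszBasis {H : Type*} [NormedAddCommGroup H] [InnerProductSpace ℂ H] (φ : ℤ → H) : Prop :=
  ∃ A B : ℝ, IsRieszBasisWithBounds φ A B

/-! The frame property is a two-sided estimate for the analysis operator `Θ y = (⟨T (g n) x, y⟩)ₙ`,
namely `√A ‖y‖ ≤ ‖Θ y‖ ≤ √B ‖y‖`. It suffices to bound the analysis operator `E` of the differences
`T (g' n) x - T (g n) x` by `l √B`, where `l = 1 - cos δγ + sin δγ`. The triangle inequality then
gives `√A - l √B` and `√B (1 + l)` for `Θ + E`, and the condition on `δ` says exactly that `l <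
√(A/B)`.

The bound on `E` is Kadec's argument. For `|θ| < π/4`, expand `exp (iθs) - 1` on `[-1, 1]`, taking
frequencies `πk` for the cosine and `π(k - 1/2)` for the sine (`Kadec.hasSum_coeff`). The
coefficients for all `|θ| ≤ δγ` have a common majorant with sum `l` (`Kadec.abs_coeff_le`,
`Kadec.hasSum_majorant`). With `θ = (g' n - g n) γ` and `s = ξ/γ` this is an expansion on the
spectrum; it must be turned into one of `T (g' n - g n) - 1` in the operators `T (frequency k / γ)`.
Each frequency then contributes a bounded multiplier applied to `Θ (T (-τ) y)`, and `T (-τ)` is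
isometric.

The passage from scalars to operators is `IsIsometricRep.tsum_smul_eq_zero`: a discrete measure
whose transform vanishes on the spectrum annihilates the representation. On a Hilbert space this
follows from Gelfand theory, since the `T t` are unitary and generate a commutative C⋆-algebra,
where an element killed by all characters is zero.

For Riesz bases the same perturbation is applied to the adjoints, that is, to the synthesis
operators. -/

/-! ### Characters of the real line and spectral synthesis in a commutative C⋆-algebra. -/

/-- A bounded continuous character of `ℝ` is `t ↦ exp (i t ξ)` for some real `ξ`. -/
theorem exists_eq_exp_of_continuous_character {u : ℝ → ℂ} (hu : Continuous u)
    (hadd : ∀ s t, u (s + t) = u s * u t) (hzero : u 0 = 1) (hnorm : ∀ t, ‖u t‖ ≤ 1) :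
    ∃ ξ : ℝ, ∀ t : ℝ, u t = Complex.exp (Complex.I * t * ξ) := by
  have hU : ∀ t : ℝ, HasDerivAt (fun t => ∫ s in (0 : ℝ)..t, u s) (u t) t := fun t =>
    intervalIntegral.integral_hasDerivAt_right (hu.intervalIntegrable _ _)
      (hu.stronglyMeasurableAtFilter _ _) hu.continuousAt
  -- The primitive has derivative `u 0 = 1` at zero, so it is not identically zero. Dividing
  -- `∫ₜ^{t+a} u = u t * ∫₀^a u` by its value at `a` shows that `u` is differentiable.
  obtain ⟨a, ha⟩ : ∃ a : ℝ, (∫ s in (0 : ℝ)..a, u s) ≠ 0 := by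
    by_contra! h
    have h0 := hU 0
    rw [funext h] at h0
    have := h0.unique (hasDerivAt_const (0 : ℝ) (0 : ℂ))
    simp [hzero] at this
  have hshift : ∀ t : ℝ, u t = ((∫ s in (0 : ℝ)..(t + a), u s) - ∫ s in (0 : ℝ)..t, u s) /
      ∫ s in (0 : ℝ)..a, u s := by
    intro t
    rw [eq_div_iff ha, ← intervalIntegral.integral_const_mul,
      intervalIntegral.integral_interval_sub_left (hu.intervalIntegrable _ _)
        (hu.intervalIntegrable _ _)]
    simp_rw [← hadd]
    rw [intervalIntegral.integral_comp_add_left (fun s => u s) t, add_zero]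
  have hdiff : DifferentiableAt ℝ u 0 := by
    rw [funext hshift]
    have h1 : DifferentiableAt ℝ (fun t : ℝ => ∫ s in (0 : ℝ)..(t + a), u s) 0 :=
      ((hU (0 + a)).comp_add_const 0 a).differentiableAt
    exact (h1.sub (hU 0).differentiableAt).div_const _
  set c := deriv u 0
  have hderiv : ∀ t : ℝ, HasDerivAt u (u t * c) t := by
    intro t
    have h1 : HasDerivAt (fun s : ℝ => u t * u (s - t)) (u t * c) t := by
      have h2 : HasDerivAt u c (t - t) := by
        rw [sub_self]; exact hdiff.hasDerivAt
      exact (h2.comp_sub_const t t).const_mul (u t)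
    have h3 : (fun s : ℝ => u t * u (s - t)) = u := by
      ext s
      rw [← hadd]; congr 1; ring
    rwa [h3] at h1
  have hexp : ∀ t : ℝ, u t = Complex.exp (c * t) := by
    have hconst : ∀ t : ℝ, HasDerivAt (fun t : ℝ => u t * Complex.exp (-(c * t))) 0 t := by
      intro t
      have h1 : HasDerivAt (fun t : ℝ => Complex.exp (-(c * t)))
          (Complex.exp (-(c * t)) * (-(c * 1))) t :=
        (((Complex.ofRealCLM.hasDerivAt (x := t)).const_mul c).neg).cexp
      refine ((hderiv t).mul h1).congr_deriv ?_
      ring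
    intro t
    have h1 := is_const_of_deriv_eq_zero (fun t => (hconst t).differentiableAt)
      (fun t => (hconst t).deriv) t 0
    simp only [hzero, Complex.ofReal_zero, mul_zero, neg_zero, Complex.exp_zero, mul_one] at h1
    rw [Complex.exp_neg, mul_inv_eq_one₀ (Complex.exp_ne_zero _)] at h1
    exact h1
  have hre : c.re = 0 := by
    have h1 := hnorm 1
    have h2 := hnorm (-1)
    rw [hexp, Complex.norm_exp, Real.exp_le_one_iff] at h1 h2
    simp at h1 h2
    linarith
  refine ⟨c.im, fun t => ?_⟩
  rw [hexp]
  congr 1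
  apply Complex.ext <;> simp [hre, mul_comm]

/-- `t ↦ f t • (U (-t) * S)` is integrable for `f ∈ L¹`, `U` bounded by one and `U * S`
norm continuous. -/
theorem integrable_smul_neg_mul {A : Type*} [NormedRing A] [NormedAlgebra ℂ A] {U : ℝ → A}
    (hnorm : ∀ t, ‖U t‖ ≤ 1) {S : A} (hS : Continuous fun t => U t * S) {f : ℝ → ℂ}
    (hf : Integrable f) : Integrable fun t => f t • (U (-t) * S) := by
  refine (hf.norm.mul_const ‖S‖).mono' (hf.1.smul
    (hS.comp continuous_neg).aestronglyMeasurable) (Filter.Eventually.of_forall fun t => ?_)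
  rw [norm_smul]
  gcongr
  exact (norm_mul_le _ _).trans (mul_le_of_le_one_left (norm_nonneg _) (hnorm _))

/-- Abstract form of spectral synthesis: if `Λ` contains every `ξ` at which the Fourier transforms
of all `f ∈ L¹` with `∫ f(t) U(-t) S dt = 0` vanish, then a discrete measure with transform
vanishing on `Λ` annihilates `S`. -/
theorem tsum_smul_mul_eq_zero_of_commCStarAlgebra {A : Type*} [CommCStarAlgebra A]
    {U : ℝ → A} (hadd : ∀ s t, U (s + t) = U s * U t) (hzero : U 0 = 1)
    (hnorm : ∀ t, ‖U t‖ ≤ 1) {S : A} (hS : Continuous fun t => U t * S) {Λ : Set ℝ}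
    (hΛ : ∀ ξ : ℝ, (∀ f : ℝ → ℂ, Integrable f → ∫ t, f t • (U (-t) * S) = 0 →
      fourierL1 f ξ = 0) → ξ ∈ Λ)
    {ι : Type*} {a : ι → ℂ} (ha : Summable fun k => ‖a k‖) {τ : ι → ℝ}
    (hvanish : ∀ ξ ∈ Λ, ∑' k, a k * Complex.exp (Complex.I * τ k * ξ) = 0) :
    (∑' k, a k • U (τ k)) * S = 0 := by
  have hsum : Summable fun k => a k • U (τ k) := by
    refine Summable.of_norm_bounded ha fun k => ?_
    rw [norm_smul]
    exact mul_le_of_le_one_right (norm_nonneg _) (hnorm _)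
  -- It is enough to test against every character `χ`. If `χ S ≠ 0`, then `χ (U t) = χ (U t * S) / χ
  -- S` is continuous in `t`, although `U` itself need not be; hence it is `exp (itξ)`, and `hΛ`
  -- puts `ξ` in `Λ`.
  apply (gelfandTransform_isometry A).injective
  rw [_root_.map_zero]
  ext χ
  change χ _ = 0
  rw [map_mul]
  have hχ : ∀ y : A, ‖χ y‖ ≤ ‖y‖ := fun y => NonUnitalStarAlgHom.norm_apply_le χ y
  by_cases hχS : χ S = 0
  · rw [hχS, mul_zero]
  have hcont : Continuous χ := map_continuous χ
  obtain ⟨ξ, hξ⟩ := exists_eq_exp_of_continuous_character (u := fun t => χ (U t))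
    (by
      have h : (fun t => χ (U t)) = fun t => χ (U t * S) / χ S := by
        ext t; rw [map_mul, mul_div_cancel_right₀ _ hχS]
      rw [h]
      exact (hcont.comp hS).div_const _)
    (fun s t => by simp only [hadd, map_mul]) (by simp only [hzero, map_one])
    (fun t => (hχ _).trans (hnorm t))
  have hmem : ξ ∈ Λ := by
    refine hΛ ξ fun f hf hf0 => ?_
    have hint := integrable_smul_neg_mul hnorm hS hf
    have h1 := (WeakDual.CharacterSpace.toCLM χ).integral_comp_comm hint
    rw [hf0, _root_.map_zero] at h1
    have h2 : ∀ t, WeakDual.CharacterSpace.toCLM χ (f t • (U (-t) * S)) =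
        (f t * Complex.exp (-(Complex.I * t * ξ))) * χ S := by
      intro t
      rw [WeakDual.CharacterSpace.coe_toCLM, map_smul, map_mul, hξ, smul_eq_mul]
      push_cast
      ring_nf
    simp_rw [h2] at h1
    rw [integral_mul_const] at h1
    exact (mul_eq_zero.1 h1).resolve_right hχS
  have h3 : χ (∑' k, a k • U (τ k)) = 0 := by
    have h4 := hsum.hasSum.map χ hcont
    rw [← h4.tsum_eq, ← hvanish ξ hmem]
    refine tsum_congr fun k => ?_
    rw [Function.comp_apply, map_smul, hξ, smul_eq_mul]
  rw [h3, zero_mul]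

/-! ### Isometric representations, smoothing by orbit integrals, and synthesis on Hilbert space. -/

namespace IsIsometricRep

section Normed

variable {X : Type*} [NormedAddCommGroup X] [NormedSpace ℂ X] {T : ℝ → X →L[ℂ] X}

theorem apply_add (hT : IsIsometricRep T) (s t : ℝ) (y : X) : T (s + t) y = T s (T t y) := by
  rw [hT.map_add]; rfl

theorem apply_apply_neg (hT : IsIsometricRep T) (t : ℝ) (y : X) : T t (T (-t) y) = y := by
  rw [← hT.apply_add, add_neg_cancel, hT.map_zero]; rfl

theorem norm_le_one (hT : IsIsometricRep T) (t : ℝ) : ‖T t‖ ≤ 1 :=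
  (T t).opNorm_le_bound zero_le_one fun y => by rw [hT.norm_map, one_mul]

theorem norm_intervalIntegral_le (hT : IsIsometricRep T) (a b : ℝ) (y : X) :
    ‖∫ t in a..b, T t y‖ ≤ |b - a| * ‖y‖ := by
  rw [mul_comm]
  exact intervalIntegral.norm_integral_le_of_norm_le_const fun t _ => (hT.norm_map t y).le

theorem commute (hT : IsIsometricRep T) (s t : ℝ) : T s * T t = T t * T s := by
  have h : ∀ s t, T s * T t = T (s + t) := fun s t => (hT.map_add s t).symm
  rw [h, h, add_comm]

/-- The operator `y ↦ ∫₀^ε T(t) y dt`. -/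
noncomputable def orbitIntegral (hT : IsIsometricRep T) (ε : ℝ) : X →L[ℂ] X :=
  LinearMap.mkContinuous
    { toFun := fun y => ∫ t in (0 : ℝ)..ε, T t y
      map_add' := fun y z => by
        simp only [_root_.map_add]
        exact intervalIntegral.integral_add ((hT.continuous_orbit y).intervalIntegrable _ _)
          ((hT.continuous_orbit z).intervalIntegrable _ _)
      map_smul' := fun c y => by
        simp only [map_smul, RingHom.id_apply]
        exact intervalIntegral.integral_smul c _ }
    |ε - 0| fun y => hT.norm_intervalIntegral_le 0 ε y

theorem orbitIntegral_apply (hT : IsIsometricRep T) (ε : ℝ) (y : X) :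
    hT.orbitIntegral ε y = ∫ t in (0 : ℝ)..ε, T t y := rfl

variable [CompleteSpace X]

theorem commute_orbitIntegral (hT : IsIsometricRep T) (ε : ℝ) {R : X →L[ℂ] X}
    (hR : ∀ t, R * T t = T t * R) : R * hT.orbitIntegral ε = hT.orbitIntegral ε * R := by
  ext y
  simp only [mul_apply_eq_comp, orbitIntegral_apply]
  rw [← R.intervalIntegral_comp_comm ((hT.continuous_orbit y).intervalIntegrable _ _)]
  refine intervalIntegral.integral_congr fun t _ => ?_
  exact congrArg (fun Q : X →L[ℂ] X => Q y) (hR t)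

/-- Smoothing turns strong continuity into norm continuity: `T s` moves the window of integration to
`[s, s + ε]`, and the integrals over two windows differ only by two end pieces of length `|s - r|`.
-/
theorem norm_sub_apply_orbitIntegral_le (hT : IsIsometricRep T) (ε s r : ℝ) :
    ‖T s * hT.orbitIntegral ε - T r * hT.orbitIntegral ε‖ ≤ 2 * |s - r| := by
  refine ContinuousLinearMap.opNorm_le_bound _ (by positivity) fun y => ?_
  have hi : ∀ a b : ℝ, IntervalIntegrable (fun t => T t y) volume a b := fun a b =>
    (hT.continuous_orbit y).intervalIntegrable a b
  have h : ∀ s : ℝ, T s (hT.orbitIntegral ε y) = ∫ t in s..(s + ε), T t y := by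
    intro s
    rw [orbitIntegral_apply, ← (T s).intervalIntegral_comp_comm (hi _ _)]
    simp_rw [← hT.apply_add]
    rw [intervalIntegral.integral_comp_add_left (fun t => T t y) s, add_zero]
  rw [sub_apply, mul_apply_eq_comp, mul_apply_eq_comp,
    h, h, intervalIntegral.integral_interval_sub_interval_comm (hi _ _) (hi _ _) (hi _ _)]
  refine (norm_sub_le _ _).trans ?_
  have h1 := hT.norm_intervalIntegral_le s r y
  have h2 := hT.norm_intervalIntegral_le (s + ε) (r + ε) y
  rw [abs_sub_comm] at h1
  rw [abs_sub_comm, add_sub_add_right_eq_sub] at h2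
  linarith

theorem continuous_mul_orbitIntegral (hT : IsIsometricRep T) (ε : ℝ) :
    Continuous fun t => T t * hT.orbitIntegral ε := by
  have h : LipschitzWith 2 fun t => T t * hT.orbitIntegral ε :=
    LipschitzWith.of_dist_le_mul fun s r => by
      rw [dist_eq_norm, Real.dist_eq]
      exact hT.norm_sub_apply_orbitIntegral_le ε s r
  exact h.continuous

/-- The orbit integrals form an approximate identity: their derivative in `ε` at zero is the
identity, strongly. Thus nothing is lost by proving operator identities only after multiplication by
them. -/
theorem eq_zero_of_mul_orbitIntegral (hT : IsIsometricRep T) {P : X →L[ℂ] X}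
    (hP : ∀ ε, P * hT.orbitIntegral ε = 0) : P = 0 := by
  ext y
  have hd : HasDerivAt (fun ε => ∫ t in (0 : ℝ)..ε, T t y) (T 0 y) 0 :=
    intervalIntegral.integral_hasDerivAt_right ((hT.continuous_orbit y).intervalIntegrable _ _)
      ((hT.continuous_orbit y).stronglyMeasurableAtFilter _ _)
      (hT.continuous_orbit y).continuousAt
  have h1 := (P.restrictScalars ℝ).hasFDerivAt.comp_hasDerivAt (0 : ℝ) hd
  have h2 : (⇑(P.restrictScalars ℝ) ∘ fun ε => ∫ t in (0 : ℝ)..ε, T t y) = fun _ => 0 := by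
    ext ε
    exact congrArg (fun Q : X →L[ℂ] X => Q y) (hP ε)
  rw [h2] at h1
  have h3 := h1.unique (hasDerivAt_const (0 : ℝ) (0 : X))
  rw [hT.map_zero] at h3
  exact h3

end Normed

section Hilbert

variable {H : Type*} [NormedAddCommGroup H] [InnerProductSpace ℂ H] {T : ℝ → H →L[ℂ] H}

theorem inner_map_map (hT : IsIsometricRep T) (t : ℝ) (y z : H) :
    inner ℂ (T t y) (T t z) = inner ℂ y z :=
  LinearIsometry.inner_map_map ⟨(T t).toLinearMap, hT.norm_map t⟩ y z

variable [CompleteSpace H]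

theorem star_eq (hT : IsIsometricRep T) (t : ℝ) : star (T t) = T (-t) := by
  rw [ContinuousLinearMap.star_eq_adjoint]
  refine ((ContinuousLinearMap.eq_adjoint_iff _ _).2 fun y z => ?_).symm
  rw [← hT.inner_map_map t, hT.apply_apply_neg]

/-- The closed star algebra generated by the representation and one of its orbit integrals. -/
noncomputable def closedAlgebra (hT : IsIsometricRep T) (ε : ℝ) : StarSubalgebra ℂ (H →L[ℂ] H) :=
  (StarAlgebra.adjoin ℂ (insert (hT.orbitIntegral ε) (Set.range T))).topologicalClosure

/-- Commutativity of the generators with each other and with their adjoints suffices. An operator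
commuting with every `T t` commutes with the orbit integral, and this applies to the adjoint of the
orbit integral because `star (T t) = T (-t)`. -/
theorem isMulCommutative_adjoin (hT : IsIsometricRep T) (ε : ℝ) : IsMulCommutative
    (StarAlgebra.adjoin ℂ (insert (hT.orbitIntegral ε) (Set.range T))) := by
  have h1 : ∀ t, T t * hT.orbitIntegral ε = hT.orbitIntegral ε * T t := fun t =>
    hT.commute_orbitIntegral ε fun s => hT.commute t s
  have h2 : ∀ t, star (hT.orbitIntegral ε) * T t = T t * star (hT.orbitIntegral ε) := by
    intro t
    have h := congrArg star (h1 (-t))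
    rw [star_mul, star_mul, hT.star_eq, neg_neg] at h
    exact h
  refine StarAlgebra.isMulCommutative_adjoin ℂ ?_ ?_
  · rintro _ (rfl | ⟨s, rfl⟩) _ (rfl | ⟨t, rfl⟩)
    exacts [rfl, (h1 t).symm, h1 s, hT.commute s t]
  · rintro _ (rfl | ⟨s, rfl⟩) _ (rfl | ⟨t, rfl⟩)
    · exact (hT.commute_orbitIntegral ε h2).symm
    · rw [hT.star_eq, h1]
    · exact (h2 s).symm
    · rw [hT.star_eq, hT.commute]

noncomputable instance commCStarAlgebraClosedAlgebra (hT : IsIsometricRep T) (ε : ℝ) :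
    CommCStarAlgebra (hT.closedAlgebra ε) :=
  { StarSubalgebra.cstarAlgebra (hT.closedAlgebra ε)
      (h_closed := StarSubalgebra.isClosed_topologicalClosure _) with
    mul_comm := fun a b => by
      have := hT.isMulCommutative_adjoin ε
      exact (StarSubalgebra.commRingTopologicalClosure _
        (fun x y => Std.Commutative.comm (op := (· * ·)) x y)).mul_comm a b }

/-- Spectral synthesis for the Beurling spectrum of a Hilbert space representation: a discrete
measure whose transform vanishes on the spectrum annihilates the representation. -/
theorem tsum_smul_eq_zero (hT : IsIsometricRep T) {ι : Type*} {a : ι → ℂ}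
    (ha : Summable fun k => ‖a k‖) {τ : ι → ℝ}
    (hvanish : ∀ ξ ∈ beurlingSpectrum T Set.univ,
      ∑' k, a k * Complex.exp (Complex.I * τ k * ξ) = 0) :
    ∑' k, a k • T (τ k) = 0 := by
  refine hT.eq_zero_of_mul_orbitIntegral fun ε => ?_
  have hmem : ∀ R ∈ insert (hT.orbitIntegral ε) (Set.range T), R ∈ hT.closedAlgebra ε := fun R hR =>
    StarSubalgebra.le_topologicalClosure _ (StarAlgebra.subset_adjoin ℂ _ hR)
  let U : ℝ → hT.closedAlgebra ε := fun t => ⟨T t, hmem _ (Or.inr ⟨t, rfl⟩)⟩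
  let S : hT.closedAlgebra ε := ⟨hT.orbitIntegral ε, hmem _ (Or.inl rfl)⟩
  let J : hT.closedAlgebra ε →L[ℂ] (H →L[ℂ] H) := (hT.closedAlgebra ε).toSubmodule.subtypeL
  have hU : ∀ t, ‖U t‖ ≤ 1 := hT.norm_le_one
  have hcont : Continuous fun t => U t * S :=
    (hT.continuous_mul_orbitIntegral ε).subtype_mk _
  have key := tsum_smul_mul_eq_zero_of_commCStarAlgebra (U := U)
    (fun s t => Subtype.ext (hT.map_add s t)) (Subtype.ext hT.map_zero) hU (S := S) hcont
    (Λ := beurlingSpectrum T Set.univ) ?_ ha hvanish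
  · have hsum : Summable fun k => a k • U (τ k) := by
      refine Summable.of_norm_bounded ha fun k => ?_
      rw [norm_smul]
      exact mul_le_of_le_one_right (norm_nonneg _) (hU _)
    have h1 := J.map_tsum hsum
    have h2 : J ((∑' k, a k • U (τ k)) * S) = J (∑' k, a k • U (τ k)) * hT.orbitIntegral ε := rfl
    rw [key, _root_.map_zero, h1] at h2
    exact h2.symm
  -- A function annihilating all of `H` annihilates in particular the vectors `S y`, hence `∫ f(t)
  -- U(-t) S dt = 0`. So the condition at `ξ` for `S` implies membership in the Beurling spectrum.
  · intro ξ hξ f hf hf0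
    refine hξ f hf ?_
    ext y
    let E : hT.closedAlgebra ε →L[ℂ] H := (ContinuousLinearMap.apply ℂ H y).comp J
    have h1 := E.integral_comp_comm (integrable_smul_neg_mul hU hcont hf)
    have h2 : ∀ t, E (f t • (U (-t) * S)) = f t • T (-t) (hT.orbitIntegral ε y) := fun t => rfl
    simp_rw [h2] at h1
    exact h1.symm.trans (hf0 _ (Set.mem_univ _))

end Hilbert

end IsIsometricRep

/-! ### Fourier series on `[-1, 1]`. -/

theorem integral_exp_I_mul_eq_sinc (w : ℝ) :
    ∫ s in (-1 : ℝ)..1, Complex.exp (Complex.I * w * s) = 2 * Real.sinc w := by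
  rcases eq_or_ne w 0 with rfl | hw
  · simp; norm_num
  · have hw' : Complex.I * (w : ℂ) ≠ 0 :=
      mul_ne_zero Complex.I_ne_zero (Complex.ofReal_ne_zero.2 hw)
    rw [integral_exp_mul_complex hw', Real.sinc_of_ne_zero hw, div_eq_iff hw']
    have h1 : Complex.I * (w : ℂ) * ((1 : ℝ) : ℂ) = w * Complex.I := by push_cast; ring
    have h2 : Complex.I * (w : ℂ) * ((-1 : ℝ) : ℂ) = ((-w : ℝ) : ℂ) * Complex.I := by
      push_cast; ring
    rw [h1, h2, Complex.exp_mul_I, Complex.exp_mul_I]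
    push_cast
    rw [Complex.cos_neg, Complex.sin_neg]
    have : (w : ℂ) ≠ 0 := Complex.ofReal_ne_zero.2 hw
    field_simp
    ring

/-- Pointwise convergence of an absolutely convergent Fourier series on `[-1, 1]`. -/
theorem hasSum_fourier_Icc {f : ℝ → ℂ} (hf : Continuous f) (hper : f (-1) = f 1) {c : ℤ → ℂ}
    (hc : ∀ k : ℤ, ∫ s in (-1 : ℝ)..1, Complex.exp (-(Complex.I * (Real.pi * k : ℝ) * s)) * f s =
      2 * c k) (hsum : Summable c) {s : ℝ} (hs : s ∈ Set.Icc (-1 : ℝ) 1) :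
    HasSum (fun k : ℤ => c k * Complex.exp (Complex.I * (Real.pi * k : ℝ) * s)) (f s) := by
  have : Fact ((0 : ℝ) < 2) := ⟨two_pos⟩
  have hper' : f (-1) = f (-1 + 2) := by rw [hper]; norm_num
  let F : C(AddCircle (2 : ℝ), ℂ) :=
    ⟨AddCircle.liftIco 2 (-1) f, AddCircle.liftIco_continuous hper' hf.continuousOn⟩
  have hexp : ∀ (k : ℤ) (s : ℝ), fourier k (s : AddCircle (2 : ℝ)) =
      Complex.exp (Complex.I * (Real.pi * k : ℝ) * s) := by
    intro k s
    rw [fourier_coe_apply]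
    congr 1
    push_cast
    ring
  have hcoeff : fourierCoeff F = c := by
    ext k
    have h1 : fourierCoeff F k = fourierCoeff (AddCircle.liftIco 2 (-1) f) k := rfl
    rw [h1, fourierCoeff_liftIco_eq, fourierCoeffOn_eq_integral]
    have h2 : (-1 : ℝ) + 2 = 1 := by norm_num
    have h3 : (-1 : ℝ) + 2 - -1 = 2 := by norm_num
    have h4 := hc k
    have h5 : ∀ s : ℝ, fourier (-k) (s : AddCircle ((-1 : ℝ) + 2 - -1)) • f s =
        Complex.exp (-(Complex.I * (Real.pi * k : ℝ) * s)) * f s := by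
      intro s
      rw [fourier_coe_apply, h3, smul_eq_mul]
      congr 2
      push_cast
      ring
    simp_rw [h5]
    rw [h2, h4, Complex.real_smul]
    push_cast
    ring
  have hF : ∀ s ∈ Set.Icc (-1 : ℝ) 1, F (s : AddCircle (2 : ℝ)) = f s := by
    intro s hs
    rcases hs.2.lt_or_eq with h | rfl
    · exact AddCircle.liftIco_coe_apply ⟨hs.1, by linarith⟩
    · have h1 : ((1 : ℝ) : AddCircle (2 : ℝ)) = ((-1 : ℝ) : AddCircle (2 : ℝ)) := by
        rw [← AddCircle.coe_add_period (2 : ℝ) (-1)]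
        norm_num
      rw [h1, ← hper]
      exact AddCircle.liftIco_coe_apply ⟨le_rfl, by norm_num⟩
  have h := has_pointwise_sum_fourier_series_of_summable (f := F) (by rwa [hcoeff])
    (s : AddCircle (2 : ℝ))
  rw [hF s hs, hcoeff] at h
  simpa only [hexp, smul_eq_mul] using h

/-! ### Kadec's expansion of `exp (iθs) - 1` and the majorant of its coefficients. -/

namespace Kadec

/-- The coefficient of `exp (iπks)` in the expansion of `cos (θs)` on `[-1, 1]`. -/
noncomputable def cosCoeff (θ : ℝ) (k : ℤ) : ℝ :=
  (Real.sinc (θ - Real.pi * k) + Real.sinc (θ + Real.pi * k)) / 2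

/-- The coefficient of `exp (iπ(k-1/2)s)` in the expansion of `i sin (θs)` on `[-1, 1]`. -/
noncomputable def sinCoeff (θ : ℝ) (k : ℤ) : ℝ :=
  (Real.sinc (θ - Real.pi * (k - 1 / 2)) - Real.sinc (θ + Real.pi * (k - 1 / 2))) / 2

theorem cosCoeff_zero (θ : ℝ) : cosCoeff θ 0 = Real.sinc θ := by
  simp [cosCoeff]

theorem sq_lt_pi_mul_sq {θ : ℝ} (hθ : |θ| < Real.pi / 4) {k : ℤ} (hk : k ≠ 0) :
    (k : ℝ) ^ 2 ≤ (Real.pi * k) ^ 2 - θ ^ 2 := by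
  have h1 : θ ^ 2 < (Real.pi / 4) ^ 2 := sq_lt_sq' (abs_lt.1 hθ).1 (abs_lt.1 hθ).2
  have h2 : (1 : ℝ) ≤ (k : ℝ) ^ 2 := by
    exact_mod_cast (one_le_sq_iff_one_le_abs k).2 (Int.one_le_abs hk)
  have h3 : 9 < Real.pi ^ 2 := by nlinarith [Real.pi_gt_three]
  have h4 : 0 ≤ ((k : ℝ) ^ 2 - 1) * (Real.pi ^ 2 - 1) := mul_nonneg (by linarith) (by linarith)
  rw [mul_pow]
  linarith

theorem sq_lt_pi_mul_sub_half_sq {θ : ℝ} (hθ : |θ| < Real.pi / 4) (k : ℤ) :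
    ((2 * k - 1 : ℤ) : ℝ) ^ 2 ≤ (Real.pi * (k - 1 / 2)) ^ 2 - θ ^ 2 := by
  have h1 : θ ^ 2 < (Real.pi / 4) ^ 2 := sq_lt_sq' (abs_lt.1 hθ).1 (abs_lt.1 hθ).2
  have h2 : (1 : ℝ) ≤ ((2 * k - 1 : ℤ) : ℝ) ^ 2 := by
    have : (2 * k - 1 : ℤ) ≠ 0 := by omega
    exact_mod_cast (one_le_sq_iff_one_le_abs (2 * k - 1)).2 (Int.one_le_abs this)
  have h3 : 9 < Real.pi ^ 2 := by nlinarith [Real.pi_gt_three]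
  have h5 : 0 ≤ (((2 * k - 1 : ℤ) : ℝ) ^ 2 - 1) * (Real.pi ^ 2 / 4 - 1) :=
    mul_nonneg (by linarith) (by linarith)
  have h4 : (Real.pi * ((k : ℝ) - 1 / 2)) ^ 2 = Real.pi ^ 2 / 4 * ((2 * k - 1 : ℤ) : ℝ) ^ 2 := by
    push_cast; ring
  rw [h4]
  linarith

theorem cosCoeff_eq {θ : ℝ} (hθ : |θ| < Real.pi / 4) {k : ℤ} (hk : k ≠ 0) :
    cosCoeff θ k = -(Real.cos (Real.pi * k) * (θ * Real.sin θ / ((Real.pi * k) ^ 2 - θ ^ 2))) := by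
  have h1 := sq_lt_pi_mul_sq hθ hk
  have h2 : (0 : ℝ) < (k : ℝ) ^ 2 := by positivity
  have h3 : (θ - Real.pi * k) * (θ + Real.pi * k) ≠ 0 := by
    intro h; nlinarith
  have hs : Real.sin (Real.pi * k) = 0 := by rw [mul_comm]; exact Real.sin_int_mul_pi k
  have h4 : (Real.pi * k) ^ 2 - θ ^ 2 ≠ 0 := by intro h; linarith
  have h5 := left_ne_zero_of_mul h3
  have h6 := right_ne_zero_of_mul h3
  rw [cosCoeff, Real.sinc_of_ne_zero h5, Real.sinc_of_ne_zero h6, Real.sin_sub, Real.sin_add, hs]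
  generalize Real.pi * (k : ℝ) = ν at *
  field_simp
  ring

theorem cos_pi_mul_sub_half (k : ℤ) : Real.cos (Real.pi * (k - 1 / 2)) = 0 := by
  have h : Real.pi * ((k : ℝ) - 1 / 2) = k * Real.pi - Real.pi / 2 := by ring
  rw [h, Real.cos_sub_pi_div_two, Real.sin_int_mul_pi]

theorem sinCoeff_eq {θ : ℝ} (hθ : |θ| < Real.pi / 4) (k : ℤ) :
    sinCoeff θ k = Real.sin (Real.pi * (k - 1 / 2)) *
      (θ * Real.cos θ / ((Real.pi * (k - 1 / 2)) ^ 2 - θ ^ 2)) := by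
  have h1 := sq_lt_pi_mul_sub_half_sq hθ k
  have h2 : (0 : ℝ) < ((2 * k - 1 : ℤ) : ℝ) ^ 2 := by
    have : ((2 * k - 1 : ℤ) : ℝ) ≠ 0 := Int.cast_ne_zero.2 (by omega)
    positivity
  have h3 : (θ - Real.pi * (k - 1 / 2)) * (θ + Real.pi * (k - 1 / 2)) ≠ 0 := by
    intro h; nlinarith
  have hc := cos_pi_mul_sub_half k
  have h4 : (Real.pi * (k - 1 / 2)) ^ 2 - θ ^ 2 ≠ 0 := by intro h; linarith
  have h5 := left_ne_zero_of_mul h3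
  have h6 := right_ne_zero_of_mul h3
  rw [sinCoeff, Real.sinc_of_ne_zero h5, Real.sinc_of_ne_zero h6, Real.sin_sub, Real.sin_add, hc]
  generalize Real.pi * ((k : ℝ) - 1 / 2) = ν at *
  field_simp
  ring

theorem summable_cosCoeff {θ : ℝ} (hθ : |θ| < Real.pi / 4) : Summable (cosCoeff θ) := by
  refine Summable.of_norm_bounded_eventually
    ((Real.summable_one_div_int_pow (p := 2)).2 one_lt_two) ?_
  filter_upwards [(Set.finite_singleton (0 : ℤ)).compl_mem_cofinite] with k hk
  have h1 := sq_lt_pi_mul_sq hθ (k := k) hk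
  have h2 : (0 : ℝ) < (k : ℝ) ^ 2 := by
    have : (k : ℝ) ≠ 0 := Int.cast_ne_zero.2 hk
    positivity
  have hπ := Real.pi_lt_four
  rw [cosCoeff_eq hθ hk, norm_neg, norm_mul, Real.norm_eq_abs, Real.norm_eq_abs, abs_div, abs_mul,
    abs_of_pos (h2.trans_le h1)]
  refine (mul_le_of_le_one_left (div_nonneg (by positivity) (h2.le.trans h1)) (Real.abs_cos_le_one _)).trans ?_
  have h3 : |θ| * |Real.sin θ| ≤ 1 :=
    mul_le_one₀ (by linarith) (abs_nonneg _) (Real.abs_sin_le_one _)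
  gcongr

theorem summable_sinCoeff {θ : ℝ} (hθ : |θ| < Real.pi / 4) : Summable (sinCoeff θ) := by
  have hs : Summable fun k : ℤ => 1 / ((2 * k - 1 : ℤ) : ℝ) ^ 2 :=
    ((Real.summable_one_div_int_pow (p := 2)).2 one_lt_two).comp_injective
      (i := fun k : ℤ => 2 * k - 1) (fun a b h => by
        have h' : 2 * a - 1 = 2 * b - 1 := h
        omega)
  refine Summable.of_norm_bounded hs fun k => ?_
  have h1 := sq_lt_pi_mul_sub_half_sq hθ k
  have h2 : (0 : ℝ) < ((2 * k - 1 : ℤ) : ℝ) ^ 2 := by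
    have : ((2 * k - 1 : ℤ) : ℝ) ≠ 0 := Int.cast_ne_zero.2 (by omega)
    positivity
  have hπ := Real.pi_lt_four
  rw [sinCoeff_eq hθ, norm_mul, Real.norm_eq_abs, Real.norm_eq_abs, abs_div, abs_mul,
    abs_of_pos (h2.trans_le h1)]
  refine (mul_le_of_le_one_left (div_nonneg (by positivity) (h2.le.trans h1)) (Real.abs_sin_le_one _)).trans ?_
  have h3 : |θ| * |Real.cos θ| ≤ 1 :=
    mul_le_one₀ (by linarith) (abs_nonneg _) (Real.abs_cos_le_one _)
  gcongr

theorem integral_exp_sub (θ ν : ℝ) :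
    ∫ s in (-1 : ℝ)..1, Complex.exp (-(Complex.I * ν * s)) * Complex.exp (Complex.I * θ * s) =
      2 * Real.sinc (θ - ν) := by
  rw [← integral_exp_I_mul_eq_sinc]
  refine intervalIntegral.integral_congr fun s _ => ?_
  rw [← Complex.exp_add]
  congr 1
  push_cast
  ring

theorem hasSum_cos {θ : ℝ} (hθ : |θ| < Real.pi / 4) {s : ℝ} (hs : s ∈ Set.Icc (-1 : ℝ) 1) :
    HasSum (fun k : ℤ => (cosCoeff θ k : ℂ) * Complex.exp (Complex.I * (Real.pi * k : ℝ) * s))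
      (Complex.cos (θ * s)) := by
  refine hasSum_fourier_Icc (f := fun s : ℝ => Complex.cos (θ * s)) (by fun_prop) (by simp)
    (fun k => ?_) (Complex.ofRealCLM.summable (summable_cosCoeff hθ)) hs
  have h1 : ∀ s : ℝ, Complex.exp (-(Complex.I * (Real.pi * k : ℝ) * s)) * Complex.cos (θ * s) =
      (Complex.exp (-(Complex.I * (Real.pi * k : ℝ) * s)) * Complex.exp (Complex.I * θ * s) +
        Complex.exp (-(Complex.I * (Real.pi * k : ℝ) * s)) *
          Complex.exp (Complex.I * (-θ : ℝ) * s)) * (1 / 2) := by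
    intro s
    rw [Complex.cos]
    push_cast
    ring_nf
  simp_rw [h1]
  rw [intervalIntegral.integral_mul_const, intervalIntegral.integral_add
    (Continuous.intervalIntegrable (by fun_prop) _ _)
    (Continuous.intervalIntegrable (by fun_prop) _ _), integral_exp_sub, integral_exp_sub,
    ← neg_add', Real.sinc_neg, Complex.ofRealCLM_apply, cosCoeff]
  push_cast
  ring

theorem hasSum_sin {θ : ℝ} (hθ : |θ| < Real.pi / 4) {s : ℝ} (hs : s ∈ Set.Icc (-1 : ℝ) 1) :
    HasSum (fun k : ℤ => (sinCoeff θ k : ℂ) *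
      Complex.exp (Complex.I * (Real.pi * (k - 1 / 2) : ℝ) * s))
      (Complex.I * Complex.sin (θ * s)) := by
  have hhalf : Complex.exp (Complex.I * (Real.pi / 2)) = Complex.I := by
    rw [mul_comm]; exact Complex.exp_pi_div_two_mul_I
  -- The odd function `i sin (θs)` takes opposite values at `±1`. The factor `exp (iπs/2)` makes the
  -- end values agree; removing it afterwards shifts the frequencies by a half-integer step.
  have h0 := hasSum_fourier_Icc
    (f := fun s : ℝ => Complex.I * Complex.sin (θ * s) * Complex.exp (Complex.I * (Real.pi / 2) * s))
    (by fun_prop) (by simp [Complex.exp_neg, hhalf]) (c := fun k => (sinCoeff θ k : ℂ))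
    (fun k => ?_) (Complex.ofRealCLM.summable (summable_sinCoeff hθ)) hs
  · have h1 := h0.mul_right (Complex.exp (-(Complex.I * (Real.pi / 2) * s)))
    rw [mul_assoc (Complex.I * _), ← Complex.exp_add, add_neg_cancel, Complex.exp_zero, mul_one] at h1
    refine h1.congr_fun fun k => ?_
    rw [mul_assoc (sinCoeff θ k : ℂ), ← Complex.exp_add]
    congr 2
    push_cast
    ring
  · have h1 : ∀ s : ℝ, Complex.exp (-(Complex.I * (Real.pi * k : ℝ) * s)) *
        (Complex.I * Complex.sin (θ * s) * Complex.exp (Complex.I * (Real.pi / 2) * s)) =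
        (Complex.exp (-(Complex.I * (Real.pi * (k - 1 / 2) : ℝ) * s)) *
          Complex.exp (Complex.I * θ * s) -
        Complex.exp (-(Complex.I * (Real.pi * (k - 1 / 2) : ℝ) * s)) *
          Complex.exp (Complex.I * (-θ : ℝ) * s)) * (1 / 2) := by
      intro s
      have h2 : Complex.exp (-(Complex.I * (Real.pi * (k - 1 / 2) : ℝ) * s)) =
          Complex.exp (-(Complex.I * (Real.pi * k : ℝ) * s)) *
            Complex.exp (Complex.I * (Real.pi / 2) * s) := by
        rw [← Complex.exp_add]
        congr 1
        push_cast
        ring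
      have h3 : Complex.I * Complex.sin (θ * s) =
          (Complex.exp (Complex.I * θ * s) - Complex.exp (Complex.I * (-θ : ℝ) * s)) / 2 := by
        rw [Complex.sin]
        have h4 : Complex.I * (θ : ℂ) * s = θ * s * Complex.I := by ring
        have h5 : Complex.I * ((-θ : ℝ) : ℂ) * s = -(θ * s) * Complex.I := by push_cast; ring
        rw [h4, h5]
        linear_combination (Complex.exp (-(θ * s) * Complex.I) -
          Complex.exp (θ * s * Complex.I)) / 2 * Complex.I_sq
      rw [h2, h3]
      ring
    simp_rw [h1]
    rw [intervalIntegral.integral_mul_const, intervalIntegral.integral_sub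
      (Continuous.intervalIntegrable (by fun_prop) _ _)
      (Continuous.intervalIntegrable (by fun_prop) _ _), integral_exp_sub, integral_exp_sub,
      ← neg_add', Real.sinc_neg, sinCoeff]
    push_cast
    ring

/-- `sinc` is the slope of the chord of `sin` from the origin, and `sin` is concave on `[0, π]`. -/
theorem sinc_le_sinc {θ Δ : ℝ} (hθ : |θ| ≤ Δ) (hΔ : Δ ≤ Real.pi) : Real.sinc Δ ≤ Real.sinc θ := by
  have heven : Real.sinc |θ| = Real.sinc θ := by
    rcases abs_choice θ with h | h <;> simp [h]
  rw [← heven]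
  rcases (abs_nonneg θ).eq_or_lt with h0 | h0
  · rw [← h0, Real.sinc_zero]; exact Real.sinc_le_one _
  have hΔ0 : 0 < Δ := h0.trans_le hθ
  rw [Real.sinc_of_ne_zero h0.ne', Real.sinc_of_ne_zero hΔ0.ne', div_le_div_iff₀ hΔ0 h0]
  have h1 := strictConcaveOn_sin_Icc.concaveOn.2
    (⟨le_rfl, Real.pi_pos.le⟩ : (0 : ℝ) ∈ Set.Icc 0 Real.pi)
    (⟨hΔ0.le, hΔ⟩ : Δ ∈ Set.Icc 0 Real.pi) (sub_nonneg.2 ((div_le_one hΔ0).2 hθ) : 0 ≤ 1 - |θ| / Δ)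
    (by positivity : 0 ≤ |θ| / Δ) (by ring)
  simp only [smul_eq_mul, Real.sin_zero, mul_zero, zero_add] at h1
  rw [div_mul_cancel₀ _ hΔ0.ne', div_mul_eq_mul_div, div_le_iff₀ hΔ0] at h1
  linarith

theorem abs_mul_cos_le {θ Δ : ℝ} (hθ : |θ| ≤ Δ) (hΔ : Δ ≤ Real.pi / 4) :
    |θ * Real.cos θ| ≤ Δ * Real.cos Δ := by
  have hmono : MonotoneOn (fun t : ℝ => t * Real.cos t) (Set.Icc 0 (Real.pi / 4)) := by
    refine monotoneOn_of_deriv_nonneg (convex_Icc _ _) (by fun_prop) (by fun_prop) fun t ht => ?_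
    rw [interior_Icc] at ht
    have hd : deriv (fun t : ℝ => t * Real.cos t) t = Real.cos t - t * Real.sin t := by
      refine (((hasDerivAt_id t).mul (Real.hasDerivAt_cos t)).congr_deriv ?_).deriv
      simp only [id_eq]
      ring
    have h1 : Real.sin t ≤ Real.cos t := by
      rw [← Real.cos_pi_div_two_sub]
      exact Real.cos_le_cos_of_nonneg_of_le_pi ht.1.le (by linarith [Real.pi_pos, ht.1])
        (by linarith [ht.2])
    have h2 : 0 ≤ Real.sin t := Real.sin_nonneg_of_nonneg_of_le_pi ht.1.le
      (by linarith [Real.pi_pos, ht.2])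
    have h3 : t ≤ 1 := by linarith [Real.pi_lt_four, ht.2]
    rw [hd]
    nlinarith
  have h := hmono ⟨abs_nonneg θ, hθ.trans hΔ⟩ ⟨(abs_nonneg θ).trans hθ, hΔ⟩ hθ
  have hc : 0 ≤ Real.cos θ := Real.cos_nonneg_of_neg_pi_div_two_le_of_le
    (by linarith [Real.pi_pos, neg_abs_le θ]) (by linarith [Real.pi_pos, le_abs_self θ])
  rw [abs_mul, abs_of_nonneg hc]
  simpa only [Real.cos_abs] using h

theorem abs_mul_sin_le {θ Δ : ℝ} (hθ : |θ| ≤ Δ) (hΔ : Δ ≤ Real.pi / 4) :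
    |θ * Real.sin θ| ≤ Δ * Real.sin Δ := by
  have hπ := Real.pi_pos
  rw [abs_mul, Real.abs_sin_eq_sin_abs_of_abs_le_pi (by linarith)]
  have h0 := abs_nonneg θ
  exact mul_le_mul hθ (Real.sin_le_sin_of_le_of_le_pi_div_two (by linarith) (by linarith) hθ)
    (Real.sin_nonneg_of_nonneg_of_le_pi h0 (by linarith)) (h0.trans hθ)

/-- The frequencies of the expansion of `exp (iθs) - 1` on `[-1, 1]`. -/
noncomputable def frequency : ℤ ⊕ ℤ → ℝ :=
  Sum.elim (fun k => Real.pi * k) fun k => Real.pi * (k - 1 / 2)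

/-- The coefficients of the expansion of `exp (iθs) - 1` on `[-1, 1]`. -/
noncomputable def coeff (θ : ℝ) : ℤ ⊕ ℤ → ℝ :=
  Sum.elim (fun k => cosCoeff θ k - if k = 0 then 1 else 0) (sinCoeff θ)

/-- The majorant of `|coeff θ|` for `|θ| ≤ Δ`. -/
noncomputable def majorant (Δ : ℝ) : ℤ ⊕ ℤ → ℝ :=
  Sum.elim (fun k => (if k = 0 then 1 else 0) - cosCoeff Δ k * Real.cos (Real.pi * k))
    fun k => sinCoeff Δ k * Real.sin (Real.pi * (k - 1 / 2))

theorem hasSum_coeff {θ : ℝ} (hθ : |θ| < Real.pi / 4) {s : ℝ} (hs : s ∈ Set.Icc (-1 : ℝ) 1) :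
    HasSum (fun k => (coeff θ k : ℂ) * Complex.exp (Complex.I * frequency k * s))
      (Complex.exp (Complex.I * θ * s) - 1) := by
  have h1 : HasSum (fun k : ℤ => if k = 0 then (1 : ℂ) else 0) 1 := hasSum_ite_eq 0 1
  have h2 : Complex.exp (Complex.I * θ * s) - 1 =
      (Complex.cos (θ * s) - 1) + Complex.I * Complex.sin (θ * s) := by
    rw [mul_assoc, mul_comm Complex.I, Complex.exp_mul_I]
    ring
  rw [h2]
  refine HasSum.sum (f := fun k => (coeff θ k : ℂ) * Complex.exp (Complex.I * frequency k * s))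
    ?_ (hasSum_sin hθ hs)
  refine ((hasSum_cos hθ hs).sub h1).congr_fun fun k => ?_
  by_cases hk : k = 0 <;> simp [coeff, frequency, hk]

/-- At `s = 1` the exponentials cancel the alternating signs of the coefficients. The sum of the
majorant is therefore read off from the two expansions at this endpoint: `1 - cos Δ` from the real
part of the first, `sin Δ` from the imaginary part of the second. -/
theorem hasSum_majorant {Δ : ℝ} (hΔ : |Δ| < Real.pi / 4) :
    HasSum (majorant Δ) (1 - Real.cos Δ + Real.sin Δ) := by
  have hone : (1 : ℝ) ∈ Set.Icc (-1 : ℝ) 1 := ⟨by norm_num, le_rfl⟩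
  refine HasSum.sum (f := majorant Δ) ?_ ?_
  · have h1 : HasSum (fun k : ℤ => if k = 0 then (1 : ℝ) else 0) 1 := hasSum_ite_eq 0 1
    have h2 := Complex.reCLM.hasSum (hasSum_cos hΔ hone)
    have h3 : Complex.reCLM (Complex.cos (Δ * (1 : ℝ))) = Real.cos Δ := by
      rw [Complex.ofReal_one, mul_one, ← Complex.ofReal_cos]
      exact Complex.ofReal_re _
    rw [h3] at h2
    refine h1.sub (h2.congr_fun fun k => ?_)
    rw [Complex.reCLM_apply, Complex.re_ofReal_mul, Complex.ofReal_one,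
      mul_one, mul_comm Complex.I, Complex.exp_ofReal_mul_I_re]
  · have h2 := Complex.imCLM.hasSum (hasSum_sin hΔ hone)
    have h3 : Complex.imCLM (Complex.I * Complex.sin (Δ * (1 : ℝ))) = Real.sin Δ := by
      rw [Complex.ofReal_one, mul_one, Complex.imCLM_apply, Complex.I_mul_im]
      exact Complex.sin_ofReal_re Δ
    rw [h3] at h2
    refine h2.congr_fun fun k => ?_
    rw [Complex.imCLM_apply, Complex.im_ofReal_mul, Complex.ofReal_one,
      mul_one, mul_comm Complex.I, Complex.exp_ofReal_mul_I_im]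
    rfl

/-- In the closed forms the numerators `|θ sin θ|` and `|θ cos θ|` grow with `|θ|` up to `π/4`,
while the positive denominators `ν² - θ²` shrink. The coefficient at `k = 0` is `sinc θ - 1`,
governed by the monotonicity of `sinc`. -/
theorem abs_coeff_le {θ Δ : ℝ} (hθ : |θ| ≤ Δ) (hΔ : Δ < Real.pi / 4) (k : ℤ ⊕ ℤ) :
    |coeff θ k| ≤ majorant Δ k := by
  have hΔ0 : 0 ≤ Δ := (abs_nonneg θ).trans hθ
  have hΔ' : |Δ| < Real.pi / 4 := by rwa [abs_of_nonneg hΔ0]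
  have hθ' := hθ.trans_lt hΔ
  have hsq : θ ^ 2 ≤ Δ ^ 2 := sq_le_sq' (abs_le.1 hθ).1 (abs_le.1 hθ).2
  rcases k with k | k
  · rcases eq_or_ne k 0 with rfl | hk
    · have h1 := sinc_le_sinc hθ (by linarith [Real.pi_pos])
      have h2 := Real.sinc_le_one θ
      simp only [coeff, majorant, Sum.elim_inl, cosCoeff_zero, if_true, Int.cast_zero, mul_zero,
        Real.cos_zero, mul_one]
      rw [abs_sub_comm, abs_of_nonneg (sub_nonneg.2 h2)]
      linarith
    · have h1 := sq_lt_pi_mul_sq hΔ' hk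
      have h2 : (0 : ℝ) < (k : ℝ) ^ 2 := by positivity
      have hc : Real.cos (Real.pi * k) ^ 2 = 1 := by
        have hs : Real.sin (Real.pi * k) = 0 := by rw [mul_comm]; exact Real.sin_int_mul_pi k
        have := Real.sin_sq_add_cos_sq (Real.pi * k)
        rw [hs] at this
        linarith
      have hca : |Real.cos (Real.pi * k)| = 1 := by
        rw [← sq_eq_sq₀ (abs_nonneg _) zero_le_one, sq_abs, hc, one_pow]
      simp only [coeff, majorant, Sum.elim_inl, if_neg hk, sub_zero, zero_sub]
      rw [cosCoeff_eq hθ' hk, cosCoeff_eq hΔ' hk, abs_neg, abs_mul, hca,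
        one_mul, abs_div, abs_of_pos (by linarith : 0 < (Real.pi * k) ^ 2 - θ ^ 2)]
      have h3 : -(-(Real.cos (Real.pi * k) * (Δ * Real.sin Δ / ((Real.pi * k) ^ 2 - Δ ^ 2))) *
          Real.cos (Real.pi * k)) = Δ * Real.sin Δ / ((Real.pi * k) ^ 2 - Δ ^ 2) := by
        linear_combination (Δ * Real.sin Δ / ((Real.pi * k) ^ 2 - Δ ^ 2)) * hc
      rw [h3]
      exact div_le_div₀ ((abs_nonneg _).trans (abs_mul_sin_le hθ hΔ.le)) (abs_mul_sin_le hθ hΔ.le)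
        (by linarith) (by linarith)
  · have h1 := sq_lt_pi_mul_sub_half_sq hΔ' k
    have h2 : (0 : ℝ) < ((2 * k - 1 : ℤ) : ℝ) ^ 2 := by
      have : ((2 * k - 1 : ℤ) : ℝ) ≠ 0 := Int.cast_ne_zero.2 (by omega)
      positivity
    have hs : Real.sin (Real.pi * (k - 1 / 2)) ^ 2 = 1 := by
      have := Real.sin_sq_add_cos_sq (Real.pi * ((k : ℝ) - 1 / 2))
      rw [cos_pi_mul_sub_half] at this
      linarith
    have hsa : |Real.sin (Real.pi * (k - 1 / 2))| = 1 := by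
      rw [← sq_eq_sq₀ (abs_nonneg _) zero_le_one, sq_abs, hs, one_pow]
    simp only [coeff, majorant, Sum.elim_inr]
    rw [sinCoeff_eq hθ', sinCoeff_eq hΔ', abs_mul, hsa, one_mul, abs_div,
      abs_of_pos (by linarith : 0 < (Real.pi * ((k : ℝ) - 1 / 2)) ^ 2 - θ ^ 2)]
    generalize Real.pi * ((k : ℝ) - 1 / 2) = ν at *
    have h3 : Real.sin ν * (Δ * Real.cos Δ / (ν ^ 2 - Δ ^ 2)) * Real.sin ν =
        Δ * Real.cos Δ / (ν ^ 2 - Δ ^ 2) := by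
      linear_combination (Δ * Real.cos Δ / (ν ^ 2 - Δ ^ 2)) * hs
    rw [h3]
    exact div_le_div₀ ((abs_nonneg _).trans (abs_mul_cos_le hθ hΔ.le)) (abs_mul_cos_le hθ hΔ.le)
      (by linarith) (by linarith)

end Kadec

/-! ### Square summable sequences and analysis operators of frames. -/

theorem lp_two_hasSum_sq (c : lp (fun _ : ℤ => ℂ) 2) :
    HasSum (fun n => ‖c n‖ ^ 2) (‖c‖ ^ 2) := by
  have h := lp.hasSum_norm (p := 2) (by norm_num) c
  simpa using h

theorem exists_lp_two_of_summable {u : ℤ → ℂ} (hu : Summable fun n => ‖u n‖ ^ 2) :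
    ∃ c : lp (fun _ : ℤ => ℂ) 2, ∀ n, c n = u n :=
  ⟨⟨u, memℓp_gen (by simpa using hu)⟩, fun _ => rfl⟩

theorem exists_lp_two_mul {M : ℝ} (hM : 0 ≤ M) {b : ℤ → ℂ} (hb : ∀ n, ‖b n‖ ≤ M)
    (c : lp (fun _ : ℤ => ℂ) 2) :
    ∃ w : lp (fun _ : ℤ => ℂ) 2, (∀ n, w n = b n * c n) ∧ ‖w‖ ≤ M * ‖c‖ := by
  have hle : ∀ n, ‖b n * c n‖ ^ 2 ≤ M ^ 2 * ‖c n‖ ^ 2 := fun n => by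
    rw [norm_mul, mul_pow]
    gcongr
    exact hb n
  have hc := (lp_two_hasSum_sq c).mul_left (M ^ 2)
  obtain ⟨w, hw⟩ := exists_lp_two_of_summable
    (hc.summable.of_nonneg_of_le (fun n => by positivity) hle)
  refine ⟨w, hw, ?_⟩
  rw [← sq_le_sq₀ (norm_nonneg _) (by positivity), mul_pow]
  exact hasSum_le (fun n => by rw [hw]; exact hle n) (lp_two_hasSum_sq w) hc

section Frames

variable {H : Type*} [NormedAddCommGroup H] [InnerProductSpace ℂ H] {φ : ℤ → H}

/-- A sequence whose coefficient sequences are square summable with norm at most `K` times the norm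
of the vector has a bounded analysis operator. -/
theorem exists_analysisOperator {K : ℝ}
    (h : ∀ y, ∃ c : lp (fun _ : ℤ => ℂ) 2, (∀ n, c n = inner ℂ (φ n) y) ∧ ‖c‖ ≤ K * ‖y‖) :
    ∃ Θ : H →L[ℂ] lp (fun _ : ℤ => ℂ) 2, ∀ y n, Θ y n = inner ℂ (φ n) y := by
  choose Θ hΘ hK using h
  refine ⟨LinearMap.mkContinuous { toFun := Θ, map_add' := fun y z => ?_, map_smul' := fun c y => ?_ }
    K hK, hΘ⟩
  · ext n
    simp [hΘ]
  · ext n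
    simp [hΘ]

theorem IsFrameWithBounds.exists_analysisOperator {A B : ℝ} (hφ : IsFrameWithBounds φ A B) :
    ∃ Θ : H →L[ℂ] lp (fun _ : ℤ => ℂ) 2, (∀ y n, Θ y n = inner ℂ (φ n) y) ∧
      ∀ y, √A * ‖y‖ ≤ ‖Θ y‖ ∧ ‖Θ y‖ ≤ √B * ‖y‖ := by
  have hA := hφ.lower_pos.le
  have hB := hA.trans hφ.lower_le_upper
  have h : ∀ y, ∃ c : lp (fun _ : ℤ => ℂ) 2, (∀ n, c n = inner ℂ (φ n) y) ∧
      ‖c‖ ^ 2 = ∑' n : ℤ, ‖inner ℂ y (φ n)‖ ^ 2 := by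
    intro y
    have hs := hφ.summable y
    -- The frame sums involve `⟨y, φ n⟩`, which is conjugate linear in `y`; swapping the arguments
    -- keeps the moduli and makes `Θ` linear.
    simp_rw [norm_inner_symm y] at hs ⊢
    obtain ⟨c, hc⟩ := exists_lp_two_of_summable hs
    exact ⟨c, hc, by simp_rw [← hc, (lp_two_hasSum_sq c).tsum_eq]⟩
  have hup : ∀ (c : lp (fun _ : ℤ => ℂ) 2) (y : H),
      ‖c‖ ^ 2 = ∑' n : ℤ, ‖inner ℂ y (φ n)‖ ^ 2 → ‖c‖ ≤ √B * ‖y‖ := by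
    intro c y hc
    rw [← sq_le_sq₀ (norm_nonneg _) (by positivity), mul_pow, Real.sq_sqrt hB, hc]
    exact hφ.upper y
  obtain ⟨Θ, hΘ⟩ := _root_.exists_analysisOperator (φ := φ) (K := √B) fun y => by
    obtain ⟨c, hc, hc2⟩ := h y
    exact ⟨c, hc, hup c y hc2⟩
  refine ⟨Θ, hΘ, fun y => ?_⟩
  obtain ⟨c, hc, hc2⟩ := h y
  have hcΘ : Θ y = c := by
    ext n
    rw [hΘ, hc]
  rw [hcΘ]
  refine ⟨?_, hup c y hc2⟩
  rw [← sq_le_sq₀ (by positivity) (norm_nonneg _), mul_pow, Real.sq_sqrt hA, hc2]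
  exact hφ.lower y

theorem isFrameWithBounds_of_analysisOperator {Θ : H →L[ℂ] lp (fun _ : ℤ => ℂ) 2}
    (hΘ : ∀ y n, Θ y n = inner ℂ (φ n) y) {a b : ℝ} (ha : 0 < a) (hab : a ≤ b)
    (hlow : ∀ y, a * ‖y‖ ≤ ‖Θ y‖) (hup : ∀ y, ‖Θ y‖ ≤ b * ‖y‖) :
    IsFrameWithBounds φ (a ^ 2) (b ^ 2) := by
  have h : ∀ y, HasSum (fun n : ℤ => ‖inner ℂ y (φ n)‖ ^ 2) (‖Θ y‖ ^ 2) := by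
    intro y
    simp_rw [norm_inner_symm y, ← hΘ]
    exact lp_two_hasSum_sq _
  refine ⟨by positivity, by gcongr, fun y => (h y).summable, fun y => ?_, fun y => ?_⟩
  · rw [(h y).tsum_eq, ← mul_pow]
    exact pow_le_pow_left₀ (by positivity) (hlow y) 2
  · rw [(h y).tsum_eq, ← mul_pow]
    exact pow_le_pow_left₀ (by positivity) (hup y) 2

/-- The frame vectors of a frame are complete. -/
theorem IsFrameWithBounds.span_topologicalClosure_eq_top [CompleteSpace H] {A B : ℝ}
    (hφ : IsFrameWithBounds φ A B) :
    (Submodule.span ℂ (Set.range φ)).topologicalClosure = ⊤ := by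
  rw [Submodule.topologicalClosure_eq_top_iff, Submodule.eq_bot_iff]
  intro y hy
  have h0 : ∀ n, inner ℂ y (φ n) = 0 := fun n =>
    (Submodule.mem_orthogonal' _ _).1 hy _ (Submodule.subset_span ⟨n, rfl⟩)
  have h := hφ.lower y
  simp only [h0, norm_zero, ne_eq, OfNat.ofNat_ne_zero, not_false_eq_true, zero_pow, tsum_zero] at h
  have h1 : ‖y‖ ^ 2 ≤ 0 := nonpos_of_mul_nonpos_right h hφ.lower_pos
  simpa using le_antisymm h1 (sq_nonneg _)

/-- The adjoint of the analysis operator is the synthesis operator. -/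
theorem hasSum_adjoint_analysisOperator [CompleteSpace H] {Θ : H →L[ℂ] lp (fun _ : ℤ => ℂ) 2}
    (hΘ : ∀ y n, Θ y n = inner ℂ (φ n) y) (c : lp (fun _ : ℤ => ℂ) 2) :
    HasSum (fun n => c n • φ n) (Θ.adjoint c) := by
  have h := (lp.hasSum_single (p := 2) (by norm_num) c).mapL Θ.adjoint
  refine h.congr_fun fun n => ?_
  refine ext_inner_right ℂ fun y => ?_
  rw [ContinuousLinearMap.adjoint_inner_left, lp.inner_single_left, hΘ, inner_smul_left]
  simp [mul_comm]

/-- A bounded below operator with injective adjoint has an adjoint with the same lower bound. -/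
theorem ContinuousLinearMap.le_norm_adjoint_of_injective {G : Type*} [NormedAddCommGroup G]
    [InnerProductSpace ℂ G] [CompleteSpace H] [CompleteSpace G] {Θ : H →L[ℂ] G} {a : ℝ}
    (hlow : ∀ y, a * ‖y‖ ≤ ‖Θ y‖) (hinj : ∀ c, Θ.adjoint c = 0 → c = 0) (c : G) :
    a * ‖c‖ ≤ ‖Θ.adjoint c‖ := by
  have hdense : DenseRange Θ := by
    have h : Θ.range.topologicalClosure = ⊤ := by
      rw [Submodule.topologicalClosure_eq_top_iff, ContinuousLinearMap.orthogonal_range,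
        Submodule.eq_bot_iff]
      exact hinj
    exact Submodule.dense_iff_topologicalClosure_eq_top.2 h
  refine hdense.induction_on (p := fun c => a * ‖c‖ ≤ ‖Θ.adjoint c‖) c
    (isClosed_le (by fun_prop) (by fun_prop)) fun y => ?_
  rcases (norm_nonneg y).eq_or_lt with hy | hy
  · rw [norm_eq_zero.1 hy.symm]; simp
  -- On the dense range of `Θ`: `a ‖y‖ ‖Θ y‖ ≤ ‖Θ y‖² = ⟨Θ* Θ y, y⟩ ≤ ‖Θ* Θ y‖ ‖y‖`, and `‖y‖`
  -- cancels.
  have h1 : ‖Θ y‖ * ‖Θ y‖ ≤ ‖Θ.adjoint (Θ y)‖ * ‖y‖ := by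
    rw [← sq, ← inner_self_eq_norm_sq (𝕜 := ℂ), ← ContinuousLinearMap.adjoint_inner_left]
    exact re_inner_le_norm _ _
  have h2 := mul_le_mul_of_nonneg_right (hlow y) (norm_nonneg (Θ y))
  nlinarith

end Frames

/-! ### Perturbation of translates. -/

section Perturbation

variable {H : Type*} [NormedAddCommGroup H] [InnerProductSpace ℂ H] [CompleteSpace H]
  {T : ℝ → H →L[ℂ] H}

/-- An absolutely convergent expansion of `exp (idξ) - 1` on the Beurling spectrum into exponentials
gives the corresponding expansion of `T d - 1`. -/
theorem IsIsometricRep.hasSum_smul_of_hasSum_exp (hT : IsIsometricRep T) {ι : Type*} {a : ι → ℂ}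
    (ha : Summable fun k => ‖a k‖) {τ : ι → ℝ} {d : ℝ}
    (h : ∀ ξ ∈ beurlingSpectrum T Set.univ, HasSum
      (fun k => a k * Complex.exp (Complex.I * τ k * ξ)) (Complex.exp (Complex.I * d * ξ) - 1)) :
    HasSum (fun k => a k • T (τ k)) (T d - 1) := by
  have hsum : Summable fun k => a k • T (τ k) := by
    refine Summable.of_norm_bounded ha fun k => ?_
    rw [norm_smul]
    exact mul_le_of_le_one_right (norm_nonneg _) (hT.norm_le_one _)
  -- Two atoms are added, of mass `-1` at `d` and `+1` at `0`, so that the expansion becomes the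
  -- vanishing of a single discrete measure.
  let a' : ι ⊕ Bool → ℂ := Sum.elim a fun b => if b then -1 else 1
  let τ' : ι ⊕ Bool → ℝ := Sum.elim τ fun b => if b then d else 0
  have key := hT.tsum_smul_eq_zero (a := a') (τ := τ')
    (Summable.sum (f := fun k => ‖a' k‖) ha Summable.of_finite) fun ξ hξ => by
      have h2 : HasSum (fun b : Bool => a' (Sum.inr b) *
          Complex.exp (Complex.I * τ' (Sum.inr b) * ξ)) (-Complex.exp (Complex.I * d * ξ) + 1) := by
        have h := hasSum_fintype fun b : Bool => a' (Sum.inr b) *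
          Complex.exp (Complex.I * τ' (Sum.inr b) * ξ)
        rw [Fintype.sum_bool] at h
        simpa [a', τ'] using h
      have h3 : HasSum (fun k => a' k * Complex.exp (Complex.I * τ' k * ξ)) _ :=
        HasSum.sum (h ξ hξ) h2
      rw [h3.tsum_eq]
      ring
  have h2 : HasSum (fun b : Bool => a' (Sum.inr b) • T (τ' (Sum.inr b))) (-T d + 1) := by
    have h := hasSum_fintype fun b : Bool => a' (Sum.inr b) • T (τ' (Sum.inr b))
    rw [Fintype.sum_bool] at h
    have hone : (1 : H →L[ℂ] H) = T 0 := hT.map_zero.symm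
    rw [hone]
    simpa [a', τ'] using h
  have h3 : HasSum (fun k => a' k • T (τ' k)) _ := HasSum.sum hsum.hasSum h2
  rw [h3.tsum_eq] at key
  have h4 : ∑' k, a k • T (τ k) = T d - 1 := by
    rw [← sub_eq_zero, ← key]
    abel
  rw [← h4]
  exact hsum.hasSum

/-- Kadec's estimate for the perturbation of a Bessel sequence of translates. -/
theorem IsIsometricRep.exists_lp_two_perturbation (hT : IsIsometricRep T) {γ : ℝ} (hγ : 0 < γ)
    (hspec : beurlingSpectrum T Set.univ ⊆ Set.Icc (-γ) γ) {x : H} {g g' : ℤ → ℝ} {K : ℝ}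
    {Θ : H →L[ℂ] lp (fun _ : ℤ => ℂ) 2} (hΘ : ∀ y n, Θ y n = inner ℂ (T (g n) x) y)
    (hK : ∀ y, ‖Θ y‖ ≤ K * ‖y‖) {δ : ℝ} (hδ : ∀ n, |g' n - g n| ≤ δ)
    (hδγ : δ * γ < Real.pi / 4) (y : H) :
    ∃ v : lp (fun _ : ℤ => ℂ) 2, (∀ n, v n = inner ℂ (T (g' n) x - T (g n) x) y) ∧
      ‖v‖ ≤ (1 - Real.cos (δ * γ) + Real.sin (δ * γ)) * (K * ‖y‖) := by
  have hθ : ∀ n, |(g' n - g n) * γ| ≤ δ * γ := fun n => by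
    rw [abs_mul, abs_of_pos hγ]
    exact mul_le_mul_of_nonneg_right (hδ n) hγ.le
  have hδγ0 : 0 ≤ δ * γ := (abs_nonneg _).trans (hθ 0)
  have hM := Kadec.hasSum_majorant (Δ := δ * γ) (by rwa [abs_of_nonneg hδγ0])
  have hcoeff : ∀ n k, ‖(Kadec.coeff ((g' n - g n) * γ) k : ℂ)‖ ≤ Kadec.majorant (δ * γ) k := by
    intro n k
    rw [Complex.norm_real, Real.norm_eq_abs]
    exact Kadec.abs_coeff_le (hθ n) hδγ k
  have hM0 : ∀ k, 0 ≤ Kadec.majorant (δ * γ) k := fun k => (norm_nonneg _).trans (hcoeff 0 k)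
  have hexp : ∀ n, HasSum (fun k => (Kadec.coeff ((g' n - g n) * γ) k : ℂ) •
      T (Kadec.frequency k / γ)) (T (g' n - g n) - 1) := by
    intro n
    refine hT.hasSum_smul_of_hasSum_exp
      (hM.summable.of_nonneg_of_le (fun k => norm_nonneg _) (hcoeff n)) fun ξ hξ => ?_
    have hξγ : ξ / γ ∈ Set.Icc (-1 : ℝ) 1 := by
      have h := hspec hξ
      exact ⟨by rw [le_div_iff₀ hγ]; linarith [h.1], by rw [div_le_iff₀ hγ]; linarith [h.2]⟩
    have h := Kadec.hasSum_coeff ((hθ n).trans_lt hδγ) hξγ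
    have hγ' : (γ : ℂ) ≠ 0 := Complex.ofReal_ne_zero.2 hγ.ne'
    have e1 : Complex.I * ((g' n - g n) * γ : ℝ) * (ξ / γ : ℝ) =
        Complex.I * (g' n - g n : ℝ) * ξ := by
      push_cast; field_simp
    rw [e1] at h
    refine h.congr_fun fun k => ?_
    congr 2
    push_cast
    field_simp
  -- For fixed frequency the coefficient depends on `n` but is bounded by the majorant uniformly in
  -- `n`, so it acts as a diagonal multiplier on `ℓ²`. This is why a majorant independent of `n` is
  -- needed.
  choose v hv hvle using fun k => exists_lp_two_mul (hM0 k) (fun n => hcoeff n k)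
    (Θ (T (-(Kadec.frequency k / γ)) y))
  have hvle' : ∀ k, ‖v k‖ ≤ Kadec.majorant (δ * γ) k * (K * ‖y‖) := fun k => by
    refine (hvle k).trans (mul_le_mul_of_nonneg_left ?_ (hM0 k))
    refine (hK _).trans_eq ?_
    rw [hT.norm_map]
  have hM' := hM.mul_right (K * ‖y‖)
  have hvsum : Summable v := Summable.of_norm_bounded hM'.summable hvle'
  refine ⟨∑' k, v k, fun n => ?_, tsum_of_norm_bounded hM' hvle'⟩
  have h1 := hvsum.hasSum.mapL (lp.evalCLM ℂ (fun _ : ℤ => ℂ) 2 n)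
  refine h1.unique ?_
  have h2 := ((hexp n).mapL (ContinuousLinearMap.apply ℂ H x)).mapL (T (g n))
  have h3 := (innerSLFlip ℂ y).hasSum h2
  have e : T (g n) ((T (g' n - g n) - 1) x) = T (g' n) x - T (g n) x := by
    have e2 : (T (g' n - g n) - 1) x = T (g' n - g n) x - x := rfl
    rw [e2, _root_.map_sub, ← hT.apply_add, add_sub_cancel]
  rw [ContinuousLinearMap.apply_apply, e, innerSLFlip_apply_apply] at h3
  refine h3.congr_fun fun k => ?_
  have e3 : T (Kadec.frequency k / γ) (T (g n) x) = T (g n) (T (Kadec.frequency k / γ) x) := by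
    rw [← hT.apply_add, ← hT.apply_add, add_comm]
  have e4 : lp.evalCLM ℂ (fun _ : ℤ => ℂ) 2 n (v k) = v k n := rfl
  -- The coefficients are real, so conjugation in the first argument leaves them unchanged; `T τ`
  -- commutes with `T (g n)` and moves to the other side as `T (-τ)`.
  rw [e4, hv, hΘ, innerSLFlip_apply_apply, ContinuousLinearMap.apply_apply, smul_apply,
    map_smul, inner_smul_left, Complex.conj_ofReal, ← e3, ← hT.inner_map_map
      (Kadec.frequency k / γ), hT.apply_apply_neg]

/-- Since `cos t - sin t = √2 sin (π/4 - t)`, the inequality `1 - cos t + sin t < r` is `(1 - r)/√2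
< sin (π/4 - t)`. This is where the arcsine bound on `δ` comes from. -/
theorem one_sub_cos_add_sin_lt {δ γ r : ℝ} (hγ : 0 < γ) (hδ : 0 ≤ δ) (hr : r ≤ 1)
    (h : δ < Real.pi / (4 * γ) - 1 / γ * Real.arcsin (1 / √2 * (1 - r))) :
    δ * γ < Real.pi / 4 - Real.arcsin (1 / √2 * (1 - r)) ∧
      1 - Real.cos (δ * γ) + Real.sin (δ * γ) < r := by
  have h1 : δ * γ < Real.pi / 4 - Real.arcsin (1 / √2 * (1 - r)) := by
    have := mul_lt_mul_of_pos_right h hγ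
    refine this.trans_eq ?_
    field_simp
  refine ⟨h1, ?_⟩
  have h0 : 0 ≤ δ * γ := by positivity
  have hπ := Real.pi_pos
  have h2 : Real.arcsin (1 / √2 * (1 - r)) < Real.pi / 4 - δ * γ := by linarith
  have harc : 0 ≤ Real.arcsin (1 / √2 * (1 - r)) :=
    Real.arcsin_nonneg.2 (mul_nonneg (by positivity) (sub_nonneg.2 hr))
  have h3 := (Real.arcsin_lt_iff_lt_sin' ⟨by linarith, by linarith⟩).1 h2
  rw [Real.sin_sub, Real.sin_pi_div_four, Real.cos_pi_div_four] at h3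
  have hs : √2 * √2 = 2 := Real.mul_self_sqrt (by norm_num)
  have hs0 : 0 < √2 := by positivity
  have h4 := mul_lt_mul_of_pos_left h3 hs0
  have e1 : √2 * (1 / √2 * (1 - r)) = 1 - r := by field_simp
  rw [e1] at h4
  nlinarith

end Perturbation

/-! ### Stability of frames and Riesz bases. -/

theorem theorem1 {H : Type*} [NormedAddCommGroup H] [InnerProductSpace ℂ H] [CompleteSpace H]
    (T : ℝ → H →L[ℂ] H) (hT : IsIsometricRep T)
    (γ : ℝ) (hγ : 0 < γ) (hspec : beurlingSpectrum T Set.univ ⊆ Set.Icc (-γ) γ)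
    (x : H) (g g' : ℤ → ℝ) (A B : ℝ)
    (hframe : IsFrameWithBounds (fun n => T (g n) x) A B)
    (δ : ℝ) (hδ : ∀ n : ℤ, |g' n - g n| ≤ δ)
    (hδ_lt : δ < Real.pi / (4 * γ) -
      1 / γ * Real.arcsin (1 / Real.sqrt 2 * (1 - Real.sqrt (A / B)))) :
    IsFrameWithBounds (fun n => T (g' n) x)
      (A * (1 - Real.sqrt (B / A) * (1 - Real.cos (δ * γ) + Real.sin (δ * γ))) ^ 2)
      (B * (2 - Real.cos (δ * γ) + Real.sin (δ * γ)) ^ 2) ∧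
    (IsRieszBasis (fun n => T (g n) x) → IsRieszBasis (fun n => T (g' n) x)) := by
  have hA := hframe.lower_pos
  have hAB := hframe.lower_le_upper
  have hB := hA.trans_le hAB
  have hδ0 : 0 ≤ δ := (abs_nonneg _).trans (hδ 0)
  have hr : √(A / B) ≤ 1 := Real.sqrt_le_one.2 ((div_le_one hB).2 hAB)
  obtain ⟨hδγ, hlt⟩ := one_sub_cos_add_sin_lt hγ hδ0 hr hδ_lt
  have harc : 0 ≤ Real.arcsin (1 / √2 * (1 - √(A / B))) :=
    Real.arcsin_nonneg.2 (mul_nonneg (by positivity) (sub_nonneg.2 hr))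
  have hδγ4 : δ * γ < Real.pi / 4 := by linarith
  have hsin : 0 ≤ Real.sin (δ * γ) := Real.sin_nonneg_of_nonneg_of_le_pi (by positivity)
    (by linarith [Real.pi_pos])
  have hl0 : 0 ≤ 1 - Real.cos (δ * γ) + Real.sin (δ * γ) := by
    linarith [Real.cos_le_one (δ * γ)]
  have hupper : 2 - Real.cos (δ * γ) + Real.sin (δ * γ) =
      1 + (1 - Real.cos (δ * γ) + Real.sin (δ * γ)) := by ring
  rw [hupper]
  obtain ⟨Θ, hΘ, hΘb⟩ := hframe.exists_analysisOperator
  have hp := hT.exists_lp_two_perturbation hγ hspec hΘ (fun y => (hΘb y).2) hδ hδγ4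
  generalize 1 - Real.cos (δ * γ) + Real.sin (δ * γ) = l at *
  rw [Real.sqrt_div hA.le] at hlt
  rw [Real.sqrt_div hB.le]
  have hα : 0 < √A := Real.sqrt_pos.2 hA
  have hβ : 0 < √B := Real.sqrt_pos.2 hB
  have hαβ : √A ≤ √B := Real.sqrt_le_sqrt hAB
  have hA2 : √A ^ 2 = A := Real.sq_sqrt hA.le
  have hB2 : √B ^ 2 = B := Real.sq_sqrt hB.le
  rw [lt_div_iff₀ hβ] at hlt
  have hlow : 0 < √A - √B * l := by linarith
  have hle : √A - √B * l ≤ √B * (1 + l) := by nlinarith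
  have eA : A * (1 - √B / √A * l) ^ 2 = (√A - √B * l) ^ 2 := by
    nth_rw 1 [← hA2]
    field_simp
  have eB : B * (1 + l) ^ 2 = (√B * (1 + l)) ^ 2 := by rw [mul_pow, hB2]
  rw [eA, eB]
  obtain ⟨E, hE⟩ := exists_analysisOperator (φ := fun n => T (g' n) x - T (g n) x) (K := l * √B)
    fun y => by
      obtain ⟨v, hv, hvle⟩ := hp y
      exact ⟨v, hv, by rwa [mul_assoc]⟩
  have hEle : ∀ y, ‖E y‖ ≤ l * √B * ‖y‖ := fun y => by
    obtain ⟨v, hv, hvle⟩ := hp y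
    have : E y = v := by
      ext n
      rw [hE, hv]
    rw [this, mul_assoc]
    exact hvle
  have hΘ' : ∀ y n, (Θ + E) y n = inner ℂ (T (g' n) x) y := fun y n => by
    have : (Θ + E) y n = Θ y n + E y n := rfl
    rw [this, hΘ, hE, ← inner_add_left, add_sub_cancel]
  have hup' : ∀ y, ‖(Θ + E) y‖ ≤ √B * (1 + l) * ‖y‖ := fun y => by
    have h1 := norm_add_le (Θ y) (E y)
    have h2 := (hΘb y).2
    have h3 := hEle y
    rw [add_apply]
    linarith
  have hlow' : ∀ y, (√A - √B * l) * ‖y‖ ≤ ‖(Θ + E) y‖ := fun y => by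
    have h1 := norm_sub_le_norm_add (Θ y) (E y)
    have h2 := (hΘb y).1
    have h3 := hEle y
    rw [add_apply]
    linarith
  have hframe' := isFrameWithBounds_of_analysisOperator hΘ' hlow hle hlow' hup'
  refine ⟨hframe', ?_⟩
  rintro ⟨A', B', hR⟩
  have hsyn := hasSum_adjoint_analysisOperator hΘ
  have hsyn' := hasSum_adjoint_analysisOperator hΘ'
  -- The lower Riesz bound makes the synthesis operator injective, so `Θ` has dense range and its
  -- adjoint inherits the lower bound `√A` of `Θ` itself. Hence the condition on `δ`, stated with
  -- the frame bounds, also serves the Riesz case whatever `A'` and `B'` are.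
  have hinj : ∀ c, Θ.adjoint c = 0 → c = 0 := fun c hc => by
    have h := hR.lower c
    rw [(hsyn c).tsum_eq, hc, norm_zero, zero_pow two_ne_zero] at h
    have h1 : ‖c‖ ^ 2 ≤ 0 := nonpos_of_mul_nonpos_right h hR.lower_pos
    simpa using le_antisymm h1 (sq_nonneg _)
  have hadj := ContinuousLinearMap.le_norm_adjoint_of_injective (fun y => (hΘb y).1) hinj
  have hEadj : ∀ c, ‖E.adjoint c‖ ≤ l * √B * ‖c‖ := fun c =>
    E.adjoint.le_of_opNorm_le (by
      rw [LinearIsometryEquiv.norm_map]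
      exact E.opNorm_le_bound (by positivity) hEle) c
  have hadd : ∀ c, (Θ + E).adjoint c = Θ.adjoint c + E.adjoint c := fun c => by
    rw [_root_.map_add, add_apply]
  refine ⟨(√A - √B * l) ^ 2, (√B * (1 + l)) ^ 2, by positivity, by gcongr,
    hframe'.span_topologicalClosure_eq_top, fun c => (hsyn' c).summable, fun c => ?_, fun c => ?_⟩
  · rw [(hsyn' c).tsum_eq, ← mul_pow, hadd]
    refine pow_le_pow_left₀ (by positivity) ?_ 2
    have h1 := norm_sub_le_norm_add (Θ.adjoint c) (E.adjoint c)
    have h2 := hadj c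
    have h3 := hEadj c
    linarith
  · rw [(hsyn' c).tsum_eq, ← mul_pow]
    refine pow_le_pow_left₀ (norm_nonneg _) ?_ 2
    refine (Θ + E).adjoint.le_of_opNorm_le ?_ c
    rw [LinearIsometryEquiv.norm_map]
    exact (Θ + E).opNorm_le_bound (by positivity) hup'
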